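/- Let $M$ be a compact smooth manifold, smoothly embedded in a Euclidean space $\mathbb R^m$ by $e:M\to\mathbb R^m$, and let $S^2=\mathbb C\cup\{\infty\}$ be the Riemann sphere. Let $k\ge 0$ be an integer and $1\le p\le\infty$ with $k-\frac2p>1$ (where $2/\infty=0$). An $L^p_k$-map $f:S^2\to M$ is a continuous map such that, in each of the two coordinates $z$ and $1/z$ of $S^2$, on the disc of radius $2$, all weak partial derivatives of order at most $k$ of $e\circ f$ exist and lie in $L^p$. The set of these maps carries the topology of the distance $\|e\circ f-e\circ h\|_{k,p}$, where $\|\cdot\|_{k,p}$ is the Sobolev norm formed from the $L^p$-norms of these derivatives. Let $\mathcal M^*$ be the subspace of non-constant $L^p_k$-maps. Let $G$ be one of the following topological groups: $PSL(2,\mathbb C)$, acting on $S^2$ by Möbius transformations; the subgroup of $PSL(2,\mathbb C)$ fixing one given point $x_1\in S^2$; the subgroup fixing each of two given distinct points $x_1,x_2\in S^2$. It acts on maps by reparametrization, $(h,g)\mapsto h\circ g$. Theorem 1.1. The action of $G$ on $\mathcal M^*$ is proper in the following sense. For any two maps $f_1,f_2\in\mathcal M^*$ there exist neighbourhoods $U(f_1)$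 and $U(f_2)$ of $f_1$ and $f_2$ in $\mathcal M^*$ and two compact sets $K_{f_1},K_{f_2}\subset G$ such that (a) for every $h\in U(f_1)$ and every $g\in G\setminus K_{f_1}$, $h\circ g\notin U(f_2)$; (b) for every $h\in U(f_2)$ and every $g\in G\setminus K_{f_2}$, $h\circ g\notin U(f_1)$. -/

import Mathlib

open MeasureTheory Set Topology
open scoped Manifold ContDiff ENNReal MatrixGroups

noncomputable section

/-! ### The group `PSL(2, ℂ)` acting on the Riemann sphere `ℂ ∪ {∞}` -/

/-- The action of `SL(2, ℂ)` on `ℂ ∪ {∞}` by Möbius transformations, as a homomorphism into the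
permutations. -/
def moebiusSL : SL(2, ℂ) →* Equiv.Perm (OnePoint ℂ) :=
  (MulAction.toPermHom (GL (Fin 2) ℂ) (OnePoint ℂ)).comp Matrix.SpecialLinearGroup.toGL

theorem center_le_ker_moebiusSL : Subgroup.center SL(2, ℂ) ≤ moebiusSL.ker := by
  intro A hA
  obtain ⟨r, hr, h⟩ := Matrix.SpecialLinearGroup.mem_center_iff.mp hA
  have h00 : A.toGL 0 0 = r := by simp [← h]
  have h11 : A.toGL 1 1 = r := by simp [← h]
  have h01 : A.toGL 0 1 = 0 := by simp [← h]
  have h10 : A.toGL 1 0 = 0 := by simp [← h]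
  have hr0 : r ≠ 0 := by
    rintro rfl
    simp at hr
  rw [MonoidHom.mem_ker]
  ext x
  change A.toGL • x = x
  cases x with
  | infty => rw [OnePoint.smul_infty_eq_ite]; simp [h10]
  | coe z => rw [OnePoint.smul_some_eq_ite]; simp [h00, h01, h10, h11, hr0]

/-- The action of `PSL(2, ℂ) = SL(2, ℂ) / center` on `ℂ ∪ {∞}` by Möbius transformations. -/
def moebiusPSL : PSL(2, ℂ) →* Equiv.Perm (OnePoint ℂ) :=
  QuotientGroup.lift _ moebiusSL center_le_ker_moebiusSL

instance instMulActionPSL : MulAction PSL(2, ℂ) (OnePoint ℂ) :=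
  MulAction.compHom (OnePoint ℂ) moebiusPSL

theorem psl_mk_smul (A : SL(2, ℂ)) (x : OnePoint ℂ) :
    (QuotientGroup.mk A : PSL(2, ℂ)) • x = A.toGL • x := rfl

/-- The three reparametrization groups: all of `PSL(2, ℂ)`, the subgroup fixing one marked point,
the subgroup fixing each of two distinct marked points. -/
def IsReparametrizationGroup (G : Subgroup PSL(2, ℂ)) : Prop :=
  G = ⊤ ∨
  (∃ x₁ : OnePoint ℂ, G = MulAction.stabilizer PSL(2, ℂ) x₁) ∨
  (∃ x₁ x₂ : OnePoint ℂ, x₁ ≠ x₂ ∧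
    G = MulAction.stabilizer PSL(2, ℂ) x₁ ⊓ MulAction.stabilizer PSL(2, ℂ) x₂)

/-! ### Weak derivatives in the plane -/

/-- The partial derivative `∂ᵃ⁺ᵇ φ / ∂xᵃ ∂yᵇ` of `φ : ℂ → ℝ`, where `z = x + i y`. -/
def classicalPartial (a b : ℕ) (φ : ℂ → ℝ) : ℂ → ℝ :=
  (fun (ψ : ℂ → ℝ) (z : ℂ) ↦ fderiv ℝ ψ z 1)^[a]
    ((fun (ψ : ℂ → ℝ) (z : ℂ) ↦ fderiv ℝ ψ z Complex.I)^[b] φ)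

/-- `v` is the weak derivative `∂ᵃ⁺ᵇ u / ∂xᵃ ∂yᵇ` of `u` on the open set `Ω`. -/
structure HasWeakPartial {V : Type*} [NormedAddCommGroup V] [NormedSpace ℝ V]
    (Ω : Set ℂ) (a b : ℕ) (u v : ℂ → V) : Prop where
  locallyIntegrableOn_fun : LocallyIntegrableOn u Ω
  locallyIntegrableOn_deriv : LocallyIntegrableOn v Ω
  integral_eq : ∀ φ : ℂ → ℝ, ContDiff ℝ ∞ φ → HasCompactSupport φ → tsupport φ ⊆ Ω →
    ∫ z, classicalPartial a b φ z • u z = (-1 : ℝ) ^ (a + b) • ∫ z, φ z • v z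

/-! ### Sobolev maps from the sphere to an embedded manifold -/

/-- The inverses of the two standard coordinates `z` and `1 / z` of `ℂ ∪ {∞}`. -/
def sphereParam : Fin 2 → ℂ → OnePoint ℂ :=
  ![fun z ↦ (z : OnePoint ℂ), fun z ↦ if z = 0 then OnePoint.infty else ((z⁻¹ : ℂ) : OnePoint ℂ)]

/-- The coordinate disc `{|z| < 2}`; its images under the two parametrizations cover the sphere. -/
def coordDisc : Set ℂ := Metric.ball 0 2

/-- Multi-indices `(a, b)` with `a + b ≤ k`. -/
abbrev MultiIndex (k : ℕ) : Type := {α : Fin (k + 1) × Fin (k + 1) // (α.1 : ℕ) + (α.2 : ℕ) ≤ k}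

/-- The space of `L^p_k` maps `S² = ℂ ∪ {∞} → M`, where `M` is embedded by `e` in a Euclidean space:
maps (represented by their continuous representative, which exists as `k - 2 / p > 0`) such that
in both coordinate discs all weak partial derivatives up to order `k` of the components of `e ∘ f`
exist and are in `L^p`. -/
structure SobolevMap (k : ℕ) (p : ℝ≥0∞) {M : Type*} [TopologicalSpace M] {m : ℕ}
    (e : M → EuclideanSpace ℝ (Fin m)) where
  toContinuousMap : C(OnePoint ℂ, M)
  exists_weakPartial : ∀ (i : Fin 2) (α : MultiIndex k), ∃ v : ℂ → EuclideanSpace ℝ (Fin m),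
    MemLp v p (volume.restrict coordDisc) ∧
    HasWeakPartial coordDisc α.1.1 α.1.2
      (fun z ↦ e (toContinuousMap (sphereParam i z))) v

namespace SobolevMap

variable {k : ℕ} {p : ℝ≥0∞} {M : Type*} [TopologicalSpace M] {m : ℕ}
  {e : M → EuclideanSpace ℝ (Fin m)}

instance : CoeFun (SobolevMap k p e) (fun _ ↦ OnePoint ℂ → M) := ⟨fun f ↦ f.toContinuousMap⟩

/-- The family of all weak derivatives `∂^α (e ∘ f)`, `|α| ≤ k`, in the two coordinate discs, as
elements of `L^p` (where they are unique). -/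
def jet (f : SobolevMap k p e) : Fin 2 → MultiIndex k →
    Lp (EuclideanSpace ℝ (Fin m)) p (volume.restrict coordDisc) :=
  fun i α ↦ (f.exists_weakPartial i α).choose_spec.1.toLp

/-- The distance `‖e ∘ f - e ∘ h‖_{k,p}`, with the Sobolev norm
`‖u‖_{k,p} = max_{i, |α| ≤ k} ‖∂^α u_i‖_{L^p}`, where `u_i` is `u` in the `i`-th coordinate disc. -/
instance [Fact (1 ≤ p)] : PseudoMetricSpace (SobolevMap k p e) :=
  PseudoMetricSpace.induced jet inferInstance

end SobolevMap

/-- The space of non-constant `L^p_k` maps, with the subspace topology. -/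
abbrev NonconstantSobolevMap (k : ℕ) (p : ℝ≥0∞) {M : Type*} [TopologicalSpace M] {m : ℕ}
    (e : M → EuclideanSpace ℝ (Fin m)) : Type _ :=
  {f : SobolevMap k p e // ∃ x y : OnePoint ℂ, f x ≠ f y}

end

/-!
The idea is that only uniform convergence is needed, together with the dynamics of divergent
sequences of Möbius transformations.

Since `k - 2 / p > 1` forces `k ≥ 2`, the distance of `SobolevMap k p e` dominates the `L¹` norms
of the weak derivatives of orders `(0, 0)`, `(1, 0)`, `(0, 1)`, `(1, 1)` on the coordinate discs,
and these dominate the sup norm on the unit discs, which cover the sphere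
(`exists_forall_norm_le_integral_weakPartial`, `SobolevMap.exists_forall_dist_le`). So maps
Sobolev-close to `f₁` and `f₂` are uniformly close to them.

If `g n` leaves every compact set of `PSL(2, ℂ)`, then lifts `A n` to `SL(2, ℂ)` have norms tending
to infinity; a limit `B` of a subsequence of `A n / ‖A n‖` is nonzero with determinant `0`.
Hence `g n` converges pointwise, along the subsequence, to the constant `[image of B]` off the
single point `[kernel of B]`. If `F₁ ∘ g n` were to converge to `F₂` uniformly, then `F₂` would be
constant off one point, so constant (`exists_forall_notMem_boundedPSL_lt_dist`).
Finally the reparametrization groups are closed in `PSL(2, ℂ)`, so compact sets of `PSL(2, ℂ)` meet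
them in compact sets.
-/

/-! ### Homogeneous coordinates on the Riemann sphere -/

/-- The point of `ℂ ∪ {∞}` with homogeneous coordinates `[v 0 : v 1]`. The value at `v = 0` is
meaningless (it is `∞`). -/
noncomputable def homogeneousPoint (v : Fin 2 → ℂ) : OnePoint ℂ :=
  if v 1 = 0 then OnePoint.infty else ((v 0 / v 1 : ℂ) : OnePoint ℂ)

/-- The normalized homogeneous coordinates: `[z : 1]` for a finite point `z`, and `[1 : 0]`
for `∞`. -/
def homogeneousCoord (x : OnePoint ℂ) : Fin 2 → ℂ :=
  x.elim ![1, 0] (fun z ↦ ![z, 1])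

theorem homogeneousCoord_ne_zero (x : OnePoint ℂ) : homogeneousCoord x ≠ 0 := by
  cases x with
  | infty => exact fun h ↦ one_ne_zero (congrFun h 0)
  | coe z => exact fun h ↦ one_ne_zero (congrFun h 1)

theorem toGL_smul_eq_homogeneousPoint (A : SL(2, ℂ)) (x : OnePoint ℂ) :
    A.toGL • x = homogeneousPoint (A.1.mulVec (homogeneousCoord x)) := by
  cases x with
  | infty =>
    rw [OnePoint.smul_infty_eq_ite]
    simp only [homogeneousPoint, homogeneousCoord, OnePoint.elim_infty, Matrix.mulVec_fin_two,
      Matrix.cons_val_zero, Matrix.cons_val_one, mul_one, mul_zero, add_zero]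
    congr
  | coe z =>
    rw [OnePoint.smul_some_eq_ite]
    simp only [homogeneousPoint, homogeneousCoord, OnePoint.elim_some, Matrix.mulVec_fin_two,
      Matrix.cons_val_zero, Matrix.cons_val_one, mul_one]
    congr

/-- Two nonzero vectors with vanishing determinant represent the same point. -/
theorem homogeneousPoint_eq_of_det_eq_zero {v w : Fin 2 → ℂ} (hv : v ≠ 0) (hw : w ≠ 0)
    (h : v 0 * w 1 = w 0 * v 1) : homogeneousPoint v = homogeneousPoint w := by
  have key : ∀ {v : Fin 2 → ℂ}, v ≠ 0 → v 1 = 0 → v 0 ≠ 0 := by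
    intro v hv h1 h0
    exact hv (funext fun i ↦ by fin_cases i <;> assumption)
  unfold homogeneousPoint
  by_cases hv1 : v 1 = 0
  · have hw1 : w 1 = 0 := by simpa [hv1, key hv hv1] using h
    simp [hv1, hw1]
  · have hw1 : w 1 ≠ 0 := by
      intro hw1
      have : w 0 = 0 := by simpa [hw1, hv1] using h
      exact key hw hw1 this
    simp only [hv1, hw1, if_false]
    rw [div_eq_div_iff hv1 hw1 |>.mpr h]

theorem homogeneousPoint_smul {c : ℂ} (hc : c ≠ 0) (v : Fin 2 → ℂ) :
    homogeneousPoint (c • v) = homogeneousPoint v := by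
  by_cases h : v 1 = 0
  · simp [homogeneousPoint, h]
  · simp [homogeneousPoint, h, hc, mul_div_mul_left]

theorem continuousAt_homogeneousPoint {v : Fin 2 → ℂ} (hv : v ≠ 0) :
    ContinuousAt homogeneousPoint v := by
  have c0 : Continuous fun w : Fin 2 → ℂ ↦ w 0 := continuous_apply 0
  have c1 : Continuous fun w : Fin 2 → ℂ ↦ w 1 := continuous_apply 1
  by_cases h1 : v 1 = 0
  · have h0 : v 0 ≠ 0 := fun h0 ↦ hv (funext fun i ↦ by fin_cases i <;> assumption)
    have hval : homogeneousPoint v = OnePoint.infty := by simp [homogeneousPoint, h1]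
    rw [ContinuousAt, hval]
    intro s hs
    rw [OnePoint.nhds_infty_eq] at hs
    obtain ⟨hs, hinf⟩ := hs
    have hs' : ∀ᶠ z : ℂ in Filter.cocompact ℂ, (z : OnePoint ℂ) ∈ s := by
      rw [Filter.coclosedCompact_eq_cocompact] at hs
      exact hs
    -- near `v` the ratio `w 1 / w 0` is small, so where `w 1 ≠ 0` its inverse is large
    have hr : Filter.Tendsto (fun w : Fin 2 → ℂ ↦ w 1 / w 0) (𝓝 v) (𝓝 0) := by
      have := (c1.tendsto v).div (c0.tendsto v) h0
      rw [h1, zero_div] at this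
      exact this
    have hinv := (Filter.tendsto_inv₀_nhdsNE_zero (α := ℂ)).eventually
      (Metric.cobounded_eq_cocompact (α := ℂ) ▸ hs')
    rw [eventually_nhdsWithin_iff] at hinv
    change ∀ᶠ w in 𝓝 v, homogeneousPoint w ∈ s
    filter_upwards [hr.eventually hinv, c0.continuousAt.eventually_ne h0] with w hw hw0
    by_cases hw1 : w 1 = 0
    · simpa [homogeneousPoint, hw1] using hinf
    · simpa [homogeneousPoint, hw1] using hw (by simp [hw0, hw1])
  · have hd : ContinuousAt (fun w : Fin 2 → ℂ ↦ ((w 0 / w 1 : ℂ) : OnePoint ℂ)) v :=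
      OnePoint.continuous_coe.continuousAt.comp
        (c0.continuousAt.div c1.continuousAt h1)
    refine hd.congr ?_
    filter_upwards [c1.continuousAt.eventually_ne h1] with w hw
    simp [homogeneousPoint, hw]

theorem continuous_sphereParam (i : Fin 2) : Continuous (sphereParam i) := by
  fin_cases i
  · exact OnePoint.continuous_coe
  · have h : sphereParam 1 = fun z : ℂ ↦ homogeneousPoint ![1, z] := by
      funext z
      simp [sphereParam, homogeneousPoint]
    change Continuous (sphereParam 1)
    rw [h, continuous_iff_continuousAt]
    intro z
    have hc : Continuous fun z : ℂ ↦ (![1, z] : Fin 2 → ℂ) := by fun_prop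
    exact (continuousAt_homogeneousPoint (fun h ↦ one_ne_zero (congrFun h 0))).comp
      hc.continuousAt

/-- The closed unit discs of the two coordinates cover the sphere. -/
theorem exists_sphereParam_eq (x : OnePoint ℂ) :
    ∃ i, ∃ z : ℂ, ‖z‖ ≤ 1 ∧ sphereParam i z = x := by
  cases x with
  | infty => exact ⟨1, 0, by simp, by simp [sphereParam]⟩
  | coe z =>
    by_cases hz : ‖z‖ ≤ 1
    · exact ⟨0, z, hz, rfl⟩
    · push Not at hz
      have h0 : z ≠ 0 := by
        rintro rfl
        simp at hz
        linarith
      refine ⟨1, z⁻¹, ?_, by simp [sphereParam, h0]⟩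
      rw [norm_inv]
      exact inv_le_one_of_one_le₀ hz.le

/-! ### Möbius transformations leaving every compact set -/

section MatrixNorm

attribute [local instance] Matrix.normedAddCommGroup Matrix.normedSpace

theorem isClosedEmbedding_specialLinearGroup_val :
    IsClosedEmbedding (fun A : SL(2, ℂ) ↦ A.1) := by
  have hc : IsClosed {A : Matrix (Fin 2) (Fin 2) ℂ | A.det = 1} :=
    isClosed_eq (by fun_prop) continuous_const
  exact hc.isClosedEmbedding_subtypeVal

/-- The image in `PSL(2, ℂ)` of the matrices of norm at most `R`. -/
def boundedPSL (R : ℝ) : Set PSL(2, ℂ) :=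
  (QuotientGroup.mk : SL(2, ℂ) → PSL(2, ℂ)) '' {A | ‖A.1‖ ≤ R}

theorem isCompact_boundedPSL (R : ℝ) : IsCompact (boundedPSL R) := by
  have h : IsCompact {A : Matrix (Fin 2) (Fin 2) ℂ | ‖A‖ ≤ R} := by
    have : ProperSpace (Matrix (Fin 2) (Fin 2) ℂ) := FiniteDimensional.proper ℂ _
    have heq : {A : Matrix (Fin 2) (Fin 2) ℂ | ‖A‖ ≤ R} = Metric.closedBall 0 R := by
      ext A
      simp
    rw [heq]
    exact isCompact_closedBall (0 : Matrix (Fin 2) (Fin 2) ℂ) R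
  exact (isClosedEmbedding_specialLinearGroup_val.isCompact_preimage h).image
    QuotientGroup.continuous_mk

/-- The kernel of a nonzero matrix is at most one point of the sphere, and no point is isolated. -/
theorem dense_mulVec_homogeneousCoord_ne_zero {B : Matrix (Fin 2) (Fin 2) ℂ} (hB : B ≠ 0) :
    Dense {x : OnePoint ℂ | B.mulVec (homogeneousCoord x) ≠ 0} := by
  by_cases hex : ∃ y : OnePoint ℂ, B.mulVec (homogeneousCoord y) = 0
  · obtain ⟨y, hy⟩ := hex
    refine (dense_compl_singleton y).mono fun x hne ↦ ?_
    rw [mem_compl_singleton_iff] at hne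
    intro hx
    apply hB
    have h0 := congrFun hx 0
    have h1 := congrFun hx 1
    have g0 := congrFun hy 0
    have g1 := congrFun hy 1
    have aux : ∀ a b z w : ℂ, z ≠ w → a * z + b = 0 → a * w + b = 0 → a = 0 ∧ b = 0 := by
      intro a b z w hzw h1 h2
      have ha : a = 0 := by
        have : a * (z - w) = 0 := by linear_combination h1 - h2
        exact (mul_eq_zero.mp this).resolve_right (sub_ne_zero.mpr hzw)
      exact ⟨ha, by simpa [ha] using h1⟩
    cases x with
    | infty =>
      cases y with
      | infty => exact absurd rfl hne
      | coe w =>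
        simp [homogeneousCoord] at h0 h1 g0 g1
        ext i j
        fin_cases i <;> fin_cases j <;> simp_all
    | coe z =>
      cases y with
      | infty =>
        simp [homogeneousCoord] at h0 h1 g0 g1
        ext i j
        fin_cases i <;> fin_cases j <;> simp_all
      | coe w =>
        simp [homogeneousCoord] at h0 h1 g0 g1
        have hzw : z ≠ w := fun h ↦ hne (by rw [h])
        obtain ⟨a1, a2⟩ := aux _ _ _ _ hzw h0 g0
        obtain ⟨a3, a4⟩ := aux _ _ _ _ hzw h1 g1
        ext i j
        fin_cases i <;> fin_cases j <;> simp_all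
  · push Not at hex
    have huniv : {x : OnePoint ℂ | B.mulVec (homogeneousCoord x) ≠ 0} = univ :=
      eq_univ_of_forall hex
    rw [huniv]
    exact dense_univ

/-- The values of a singular matrix are proportional. -/
theorem mulVec_det_eq_zero {B : Matrix (Fin 2) (Fin 2) ℂ} (hB : B.det = 0) (v w : Fin 2 → ℂ) :
    (B.mulVec v) 0 * (B.mulVec w) 1 = (B.mulVec w) 0 * (B.mulVec v) 1 := by
  rw [Matrix.det_fin_two] at hB
  simp only [Matrix.mulVec_fin_two, Matrix.cons_val_zero, Matrix.cons_val_one]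
  linear_combination (v 0 * w 1 - v 1 * w 0) * hB

/-- A sequence in `SL(2, ℂ)` with norms tending to infinity has a subsequence converging, in
projective space, to a singular nonzero matrix. -/
theorem exists_subseq_normalized_tendsto_singular (A : ℕ → SL(2, ℂ))
    (hA : Filter.Tendsto (fun n ↦ ‖(A n).1‖) Filter.atTop Filter.atTop) :
    ∃ B : Matrix (Fin 2) (Fin 2) ℂ, B ≠ 0 ∧ B.det = 0 ∧ ∃ φ : ℕ → ℕ, StrictMono φ ∧
      Filter.Tendsto (fun n ↦ ((‖(A (φ n)).1‖⁻¹ : ℝ) : ℂ) • (A (φ n)).1) Filter.atTop (𝓝 B) := by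
  have : ProperSpace (Matrix (Fin 2) (Fin 2) ℂ) := FiniteDimensional.proper ℂ _
  have hne : ∀ n, ‖(A n).1‖ ≠ 0 := by
    intro n h
    have h1 := (A n).2
    rw [norm_eq_zero.mp h] at h1
    simp at h1
  obtain ⟨B, hB, φ, hφ, hlim⟩ := (isCompact_sphere (0 : Matrix (Fin 2) (Fin 2) ℂ) 1).tendsto_subseq
    (x := fun n ↦ ((‖(A n).1‖⁻¹ : ℝ) : ℂ) • (A n).1)
    (fun n ↦ by simp [norm_smul, hne n])
  refine ⟨B, fun h ↦ by simp [h] at hB, ?_, φ, hφ, hlim⟩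
  have hd : Filter.Tendsto (fun n ↦ (((‖(A (φ n)).1‖⁻¹ : ℝ) : ℂ) • (A (φ n)).1).det)
      Filter.atTop (𝓝 B.det) :=
    ((by fun_prop : Continuous fun B : Matrix (Fin 2) (Fin 2) ℂ ↦ B.det).tendsto B).comp hlim
  have h0 : Filter.Tendsto (fun n ↦ ((‖(A (φ n)).1‖⁻¹ : ℝ) : ℂ) ^ 2) Filter.atTop (𝓝 0) := by
    have h1 : Filter.Tendsto (fun n ↦ ‖(A (φ n)).1‖⁻¹) Filter.atTop (𝓝 0) :=
      tendsto_inv_atTop_zero.comp (hA.comp hφ.tendsto_atTop)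
    have h2 := ((Complex.continuous_ofReal.tendsto 0).comp h1).pow 2
    simpa [Function.comp_def] using h2
  refine tendsto_nhds_unique hd (h0.congr fun n ↦ ?_)
  rw [Matrix.det_smul, (A (φ n)).2]
  simp

/-- Let `F₁`, `F₂` be continuous maps of the sphere, `F₂` non-constant. Then `F₂` is not uniformly
close to `F₁ ∘ g` unless `g` lies in a compact set. Otherwise there would be a divergent sequence
`g n` with `F₁ ∘ g n → F₂`; a divergent sequence has a subsequence converging pointwise to a
constant off a single point, and then `F₂` is constant. -/
theorem exists_forall_notMem_boundedPSL_lt_dist {Y : Type*} [MetricSpace Y]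
    {F₁ F₂ : OnePoint ℂ → Y} (h₁ : Continuous F₁) (h₂ : Continuous F₂)
    (hF₂ : ∃ x y, F₂ x ≠ F₂ y) :
    ∃ δ > 0, ∃ R : ℝ, ∀ g : PSL(2, ℂ), g ∉ boundedPSL R → ∃ x, δ ≤ dist (F₂ x) (F₁ (g • x)) := by
  by_contra hcon
  push Not at hcon
  choose g hg hdist using fun n : ℕ ↦ hcon (1 / ((n : ℝ) + 1)) (by positivity) n
  choose A hA using fun n ↦ QuotientGroup.mk_surjective (g n)
  have hAn : Filter.Tendsto (fun n ↦ ‖(A n).1‖) Filter.atTop Filter.atTop := by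
    refine Filter.tendsto_atTop_mono (fun n ↦ ?_) tendsto_natCast_atTop_atTop
    by_contra hlt
    exact hg n ⟨A n, (not_le.mp hlt).le, hA n⟩
  obtain ⟨B, hB0, hBdet, φ, hφ, hlim⟩ := exists_subseq_normalized_tendsto_singular A hAn
  have hF : ∀ x, B.mulVec (homogeneousCoord x) ≠ 0 →
      F₂ x = F₁ (homogeneousPoint (B.mulVec (homogeneousCoord x))) := by
    intro x hx
    have hmul : Filter.Tendsto
        (fun n ↦ (((‖(A (φ n)).1‖⁻¹ : ℝ) : ℂ) • (A (φ n)).1).mulVec (homogeneousCoord x))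
        Filter.atTop (𝓝 (B.mulVec (homogeneousCoord x))) :=
      ((by fun_prop : Continuous fun B : Matrix (Fin 2) (Fin 2) ℂ ↦
        B.mulVec (homogeneousCoord x)).tendsto B).comp hlim
    have hpt := (h₁.tendsto _).comp ((continuousAt_homogeneousPoint hx).tendsto.comp hmul)
    have hpt' : Filter.Tendsto (fun n ↦ F₁ (g (φ n) • x)) Filter.atTop
        (𝓝 (F₁ (homogeneousPoint (B.mulVec (homogeneousCoord x))))) := by
      refine hpt.congr' ?_
      filter_upwards [(hAn.comp hφ.tendsto_atTop).eventually_gt_atTop 0] with n hn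
      have hc : ((‖(A (φ n)).1‖⁻¹ : ℝ) : ℂ) ≠ 0 := by
        exact_mod_cast inv_ne_zero (ne_of_gt hn)
      simp only [Function.comp_apply]
      rw [Matrix.smul_mulVec, homogeneousPoint_smul hc, ← toGL_smul_eq_homogeneousPoint,
        ← psl_mk_smul, hA]
    have hF₂x : Filter.Tendsto (fun n ↦ F₁ (g (φ n) • x)) Filter.atTop (𝓝 (F₂ x)) := by
      rw [tendsto_iff_dist_tendsto_zero]
      refine squeeze_zero (fun _ ↦ dist_nonneg) (fun n ↦ ?_)
        ((tendsto_one_div_add_atTop_nhds_zero_nat (𝕜 := ℝ)).comp hφ.tendsto_atTop)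
      rw [dist_comm]
      exact (hdist (φ n) x).le
    exact tendsto_nhds_unique hF₂x hpt'
  have hconst : ∀ x y, B.mulVec (homogeneousCoord x) ≠ 0 → B.mulVec (homogeneousCoord y) ≠ 0 →
      F₂ x = F₂ y := by
    intro x y hx hy
    rw [hF x hx, hF y hy,
      homogeneousPoint_eq_of_det_eq_zero hx hy (mulVec_det_eq_zero hBdet _ _)]
  have hdense := dense_mulVec_homogeneousCoord_ne_zero hB0
  obtain ⟨x₀, hx₀⟩ := hdense.nonempty
  have hall : F₂ = fun _ ↦ F₂ x₀ :=
    h₂.ext_on hdense continuous_const fun x hx ↦ hconst x x₀ hx hx₀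
  obtain ⟨x, y, hxy⟩ := hF₂
  exact hxy (by rw [hall])

/-! ### The reparametrization groups are closed -/

theorem isClosed_stabilizer_PSL (x : OnePoint ℂ) :
    IsClosed (MulAction.stabilizer PSL(2, ℂ) x : Set PSL(2, ℂ)) := by
  have hq : IsQuotientMap (QuotientGroup.mk : SL(2, ℂ) → PSL(2, ℂ)) :=
    QuotientGroup.isQuotientMap_mk _
  rw [← hq.isClosed_preimage]
  have hcont : Continuous fun A : SL(2, ℂ) ↦ homogeneousPoint (A.1.mulVec (homogeneousCoord x)) := by
    rw [continuous_iff_continuousAt]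
    intro A
    have hA : A.1.mulVec (homogeneousCoord x) ≠ 0 := by
      intro h
      apply homogeneousCoord_ne_zero x
      exact Matrix.eq_zero_of_mulVec_eq_zero (by rw [A.2]; exact one_ne_zero) h
    have hc : Continuous fun A : SL(2, ℂ) ↦ A.1.mulVec (homogeneousCoord x) :=
      (by fun_prop : Continuous fun B : Matrix (Fin 2) (Fin 2) ℂ ↦
        B.mulVec (homogeneousCoord x)).comp isClosedEmbedding_specialLinearGroup_val.continuous
    exact ContinuousAt.comp (f := fun A : SL(2, ℂ) ↦ A.1.mulVec (homogeneousCoord x))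
      (continuousAt_homogeneousPoint hA) hc.continuousAt
  have : (QuotientGroup.mk : SL(2, ℂ) → PSL(2, ℂ)) ⁻¹'
      (MulAction.stabilizer PSL(2, ℂ) x : Set PSL(2, ℂ)) =
      {A | homogeneousPoint (A.1.mulVec (homogeneousCoord x)) = x} := by
    ext A
    rw [mem_preimage, SetLike.mem_coe, MulAction.mem_stabilizer_iff, psl_mk_smul,
      toGL_smul_eq_homogeneousPoint]
    rfl
  rw [this]
  exact isClosed_eq hcont continuous_const

theorem IsReparametrizationGroup.isClosed {G : Subgroup PSL(2, ℂ)}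
    (hG : IsReparametrizationGroup G) : IsClosed (G : Set PSL(2, ℂ)) := by
  rcases hG with rfl | ⟨x, rfl⟩ | ⟨x, y, -, rfl⟩
  · simp
  · exact isClosed_stabilizer_PSL x
  · exact (isClosed_stabilizer_PSL x).inter (isClosed_stabilizer_PSL y)

end MatrixNorm

/-! ### A sup bound by the `L¹` norms of weak derivatives -/

/-- A mollifier `ρ` supported in `[-ε, ε]` with a smooth primitive `h` bounded by `1`, uniformly
in `ε`. The primitive `∫₀ᵗ ρ` need not vanish on the left, because it is only used multiplied by a
compactly supported cutoff. -/
theorem exists_smooth_primitive_of_bump {ε : ℝ} (hε : 0 < ε) :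
    ∃ h ρ : ℝ → ℝ, ContDiff ℝ ∞ h ∧ Continuous ρ ∧ (∀ t, HasDerivAt h (ρ t) t) ∧
      (∀ t, |h t| ≤ 1) ∧ (∀ t, 0 ≤ ρ t) ∧ (∀ t, ε ≤ |t| → ρ t = 0) ∧ Integrable ρ ∧
      ∫ t, ρ t = 1 := by
  let b : ContDiffBump (0 : ℝ) := ⟨ε / 2, ε, by positivity, by linarith⟩
  have hc : Continuous (b.normed volume) := b.continuous_normed
  have hint : Integrable (b.normed volume) := b.integrable_normed
  have hd : ∀ t, HasDerivAt (fun t ↦ ∫ s in (0 : ℝ)..t, b.normed volume s)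
      (b.normed volume t) t := fun t ↦
    intervalIntegral.integral_hasDerivAt_right (hc.intervalIntegrable _ _)
      (hc.stronglyMeasurableAtFilter _ _) hc.continuousAt
  refine ⟨fun t ↦ ∫ s in (0 : ℝ)..t, b.normed volume s, b.normed volume, ?_, hc, hd, ?_,
    b.nonneg_normed, ?_, hint, b.integral_normed⟩
  · rw [contDiff_infty_iff_deriv]
    refine ⟨fun t ↦ (hd t).differentiableAt, ?_⟩
    rw [funext fun t ↦ (hd t).deriv]
    exact b.contDiff_normed (n := ⊤)
  · intro t
    rw [← Real.norm_eq_abs]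
    calc ‖∫ s in (0 : ℝ)..t, b.normed volume s‖
        ≤ ∫ s in uIoc 0 t, ‖b.normed volume s‖ :=
          intervalIntegral.norm_integral_le_integral_norm_uIoc
      _ ≤ ∫ s, ‖b.normed volume s‖ :=
          setIntegral_le_integral hint.norm (Filter.Eventually.of_forall fun _ ↦ norm_nonneg _)
      _ = ∫ s, b.normed volume s := by
          simp_rw [Real.norm_of_nonneg (b.nonneg_normed _)]
      _ = 1 := b.integral_normed
  · intro t ht
    have : t ∉ Function.support (b.normed volume) := by
      rw [b.support_normed_eq]
      simpa [b] using ht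
    simpa using this

theorem integral_re_mul_im (ρ : ℝ → ℝ) :
    ∫ z : ℂ, ρ z.re * ρ z.im = (∫ t, ρ t) * ∫ t, ρ t := by
  rw [← integral_prod_mul, ← Measure.volume_eq_prod,
    ← Complex.volume_preserving_equiv_real_prod.integral_comp
      Complex.measurableEquivRealProd.measurableEmbedding]
  rfl

theorem integrable_re_mul_im {ρ : ℝ → ℝ} (hρ : Integrable ρ) :
    Integrable fun z : ℂ ↦ ρ z.re * ρ z.im := by
  have h := hρ.mul_prod hρ
  rw [← Measure.volume_eq_prod] at h
  exact (Complex.volume_preserving_equiv_real_prod.integrable_comp_emb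
    Complex.measurableEquivRealProd.measurableEmbedding).mpr h

section Partials

variable {f g : ℂ → ℝ}

theorem ContDiff.fderiv_direction (hf : ContDiff ℝ ∞ f) (c : ℂ) :
    ContDiff ℝ ∞ fun z ↦ fderiv ℝ f z c :=
  (hf.fderiv_right (m := ∞) (by simp)).clm_apply contDiff_const

theorem fderiv_mul_direction (hf : ContDiff ℝ ∞ f) (hg : ContDiff ℝ ∞ g) (c z : ℂ) :
    fderiv ℝ (fun z ↦ f z * g z) z c = f z * fderiv ℝ g z c + fderiv ℝ f z c * g z := by
  rw [fderiv_fun_mul (hf.differentiable (by simp) z) (hg.differentiable (by simp) z)]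
  simp [mul_comm]

/-- The Leibniz identity behind the sup bound: `χ ∂ₓ∂ᵧ H` is a combination of derivatives of
products in which `H` itself is not differentiated. -/
theorem mul_fderiv_fderiv_eq {χ H : ℂ → ℝ} (hχ : ContDiff ℝ ∞ χ) (hH : ContDiff ℝ ∞ H)
    (c d z : ℂ) :
    χ z * fderiv ℝ (fun w ↦ fderiv ℝ H w d) z c =
      fderiv ℝ (fun w ↦ fderiv ℝ (fun w ↦ χ w * H w) w d) z c
      - fderiv ℝ (fun w ↦ fderiv ℝ χ w d * H w) z c
      - fderiv ℝ (fun w ↦ fderiv ℝ χ w c * H w) z d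
      + fderiv ℝ (fun w ↦ fderiv ℝ χ w c) z d * H z := by
  have hχc := hχ.fderiv_direction c
  have hχd := hχ.fderiv_direction d
  have hHd := hH.fderiv_direction d
  have h1 : (fun w ↦ fderiv ℝ (fun w ↦ χ w * H w) w d) =
      fun w ↦ χ w * fderiv ℝ H w d + fderiv ℝ χ w d * H w :=
    funext fun w ↦ fderiv_mul_direction hχ hH d w
  have h2 : fderiv ℝ (fun w ↦ χ w * fderiv ℝ H w d + fderiv ℝ χ w d * H w) z c =
      fderiv ℝ (fun w ↦ χ w * fderiv ℝ H w d) z c + fderiv ℝ (fun w ↦ fderiv ℝ χ w d * H w) z c := by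
    rw [fderiv_fun_add ((hχ.mul hHd).differentiable (by simp) z)
      ((hχd.mul hH).differentiable (by simp) z)]
    rfl
  rw [h1, h2, fderiv_mul_direction hχ hHd, fderiv_mul_direction hχc hH]
  ring

end Partials

section SupBound

variable {V : Type*} [NormedAddCommGroup V] [NormedSpace ℝ V]

theorem norm_integral_mul_smul_le {ψ H : ℂ → ℝ} {v : ℂ → V} {C : ℝ}
    (hψ : ∀ z, ‖ψ z‖ ≤ C) (hsupp : tsupport ψ ⊆ coordDisc) (hH : ∀ z, ‖H z‖ ≤ 1)
    (hv : IntegrableOn v coordDisc) :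
    ‖∫ z, (ψ z * H z) • v z‖ ≤ C * ∫ z in coordDisc, ‖v z‖ := by
  have h0 : ∫ z, (ψ z * H z) • v z = ∫ z in coordDisc, (ψ z * H z) • v z := by
    refine (setIntegral_eq_integral_of_forall_compl_eq_zero fun z hz ↦ ?_).symm
    have : ψ z = 0 := image_eq_zero_of_notMem_tsupport fun h ↦ hz (hsupp h)
    simp [this]
  rw [h0, ← integral_const_mul]
  refine norm_integral_le_of_norm_le (hv.norm.const_mul C) (Filter.Eventually.of_forall fun z ↦ ?_)
  rw [norm_smul, norm_mul]
  have hC : ‖ψ z‖ * ‖H z‖ ≤ C * 1 :=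
    mul_le_mul (hψ z) (hH z) (norm_nonneg _) ((norm_nonneg _).trans (hψ z))
  rw [mul_one] at hC
  gcongr

/-- A continuous function is bounded at a point by any common bound for its averages against
products of mollifiers. It suffices to have the bound for mollifiers with a bounded smooth
primitive `h`. -/
theorem norm_le_of_norm_integral_mollifier_le [CompleteSpace V] {w : ℂ → V} (hw : Continuous w)
    (z₀ : ℂ) {C : ℝ}
    (hC : ∀ h ρ : ℝ → ℝ, ContDiff ℝ ∞ h → (∀ t, HasDerivAt h (ρ t) t) → (∀ t, |h t| ≤ 1) →
      ‖∫ z : ℂ, (ρ (z - z₀).re * ρ (z - z₀).im) • w z‖ ≤ C) : ‖w z₀‖ ≤ C := by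
  refine le_of_forall_pos_le_add fun δ hδ ↦ ?_
  obtain ⟨ε, hε, hwε⟩ := Metric.continuous_iff.mp hw z₀ δ hδ
  obtain ⟨h, ρ, hh, hρc, hd, hb, hρ0, hρz, hρi, hρ1⟩ :=
    exists_smooth_primitive_of_bump (half_pos hε)
  have hbound := hC h ρ hh hd hb
  let η : ℂ → ℝ := fun z ↦ ρ (z - z₀).re * ρ (z - z₀).im
  have hηi : Integrable η := (integrable_re_mul_im hρi).comp_sub_right z₀
  have hη1 : ∫ z, η z = 1 := by
    change ∫ z, (fun z : ℂ ↦ ρ z.re * ρ z.im) (z - z₀) = 1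
    rw [integral_sub_right_eq_self (fun z : ℂ ↦ ρ z.re * ρ z.im), integral_re_mul_im, hρ1, one_mul]
  have hη0 : ∀ z, 0 ≤ η z := fun z ↦ mul_nonneg (hρ0 _) (hρ0 _)
  have hclose : ∀ z, ‖η z • (w z₀ - w z)‖ ≤ η z * δ := by
    intro z
    rw [norm_smul, Real.norm_of_nonneg (hη0 z)]
    by_cases hz : dist z z₀ < ε
    · gcongr
      · exact hη0 z
      · rw [← dist_eq_norm, dist_comm]
        exact (hwε z hz).le
    -- outside the disc of radius `ε` one coordinate has modulus at least `ε / 2`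
    · have hz0 : η z = 0 := by
        have hle : ε ≤ |(z - z₀).re| + |(z - z₀).im| :=
          (not_lt.mp hz).trans ((dist_eq_norm z z₀).le.trans (Complex.norm_le_abs_re_add_abs_im _))
        by_cases h1 : ε / 2 ≤ |(z - z₀).re|
        · simp only [η, hρz _ h1, zero_mul]
        · simp only [η, hρz _ (show ε / 2 ≤ |(z - z₀).im| by linarith), mul_zero]
      simp [hz0]
  have hηc : Continuous η := by
    have h1 : Continuous fun z : ℂ ↦ (z - z₀).re := by fun_prop
    have h2 : Continuous fun z : ℂ ↦ (z - z₀).im := by fun_prop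
    exact (hρc.comp h1).mul (hρc.comp h2)
  have hint2 : Integrable fun z ↦ η z • (w z₀ - w z) :=
    (hηi.mul_const δ).mono' (by fun_prop) (Filter.Eventually.of_forall hclose)
  have hsplit : w z₀ = (∫ z, η z • w z) + ∫ z, η z • (w z₀ - w z) := by
    have hint1 : Integrable fun z ↦ η z • w z := by
      refine ((hηi.smul_const (w z₀)).sub hint2).congr (Filter.Eventually.of_forall fun z ↦ ?_)
      simp [smul_sub]
    rw [← integral_add hint1 hint2]
    simp only [smul_sub, add_sub_cancel]
    rw [integral_smul_const, hη1, one_smul]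
  calc ‖w z₀‖ ≤ ‖∫ z, η z • w z‖ + ‖∫ z, η z • (w z₀ - w z)‖ := by
        conv_lhs => rw [hsplit]
        exact norm_add_le _ _
    _ ≤ C + δ := by
        refine add_le_add hbound ?_
        refine (norm_integral_le_of_norm_le (hηi.mul_const δ)
          (Filter.Eventually.of_forall hclose)).trans ?_
        rw [integral_mul_const, hη1, one_mul]

theorem HasWeakPartial.sub {Ω : Set ℂ} {a b : ℕ} {u₁ u₂ v₁ v₂ : ℂ → V}
    (h₁ : HasWeakPartial Ω a b u₁ v₁) (h₂ : HasWeakPartial Ω a b u₂ v₂)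
    (hu₁ : Continuous u₁) (hu₂ : Continuous u₂)
    (hv₁ : IntegrableOn v₁ Ω) (hv₂ : IntegrableOn v₂ Ω) :
    HasWeakPartial Ω a b (fun z ↦ u₁ z - u₂ z) (fun z ↦ v₁ z - v₂ z) := by
  refine ⟨h₁.1.sub h₂.1, h₁.2.sub h₂.2, fun φ hφ hc hs ↦ ?_⟩
  have hiter : ∀ (c : ℂ) (n : ℕ) {ψ : ℂ → ℝ}, ContDiff ℝ ∞ ψ → HasCompactSupport ψ →
      ContDiff ℝ ∞ ((fun (ψ : ℂ → ℝ) (z : ℂ) ↦ fderiv ℝ ψ z c)^[n] ψ) ∧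
      HasCompactSupport ((fun (ψ : ℂ → ℝ) (z : ℂ) ↦ fderiv ℝ ψ z c)^[n] ψ) := by
    intro c n
    induction n with
    | zero => exact fun h h' ↦ ⟨h, h'⟩
    | succ n ih =>
      intro ψ h h'
      exact ih (h.fderiv_direction c) (h'.fderiv_apply ℝ c)
  have hb := hiter Complex.I b hφ hc
  have hab : ContDiff ℝ ∞ (classicalPartial a b φ) ∧ HasCompactSupport (classicalPartial a b φ) :=
    hiter 1 a hb.1 hb.2
  have hiu : ∀ {u : ℂ → V}, Continuous u → Integrable fun z ↦ classicalPartial a b φ z • u z :=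
    fun hu ↦ (hab.1.continuous.smul hu).integrable_of_hasCompactSupport hab.2.smul_right
  have hiv : ∀ {v : ℂ → V}, IntegrableOn v Ω → Integrable fun z ↦ φ z • v z := by
    intro v hv
    obtain ⟨C, hC⟩ := hc.exists_bound_of_continuous hφ.continuous
    have hon : IntegrableOn (fun z ↦ φ z • v z) Ω :=
      hv.bdd_smul C hφ.continuous.aestronglyMeasurable (Filter.Eventually.of_forall hC)
    refine (integrableOn_iff_integrable_of_support_subset fun z hz ↦ ?_).mp hon
    refine hs (subset_tsupport _ fun h0 ↦ hz ?_)
    simp [h0]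
  simp only [smul_sub]
  rw [integral_sub (hiu hu₁) (hiu hu₂), integral_sub (hiv hv₁) (hiv hv₂), smul_sub,
    h₁.3 φ hφ hc hs, h₂.3 φ hφ hc hs]

/-- The Sobolev inequality `W^{2,1} ⊂ C⁰` in the plane, on a smaller disc. For a cutoff `χ` and
`H (x + iy) = h (x - x₀) h (y - y₀)`, where `h` is a bounded primitive of a mollifier, the average
`∫ χ u ∂ₓ∂ᵧ H` is close to `u z₀`, and all derivatives can be moved from `H` to `u` and `χ`. -/
theorem exists_forall_norm_le_integral_weakPartial [CompleteSpace V] :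
    ∃ C : ℝ, 0 ≤ C ∧ ∀ u v₀₀ v₁₀ v₀₁ v₁₁ : ℂ → V, Continuous u →
      HasWeakPartial coordDisc 0 0 u v₀₀ → HasWeakPartial coordDisc 1 0 u v₁₀ →
      HasWeakPartial coordDisc 0 1 u v₀₁ → HasWeakPartial coordDisc 1 1 u v₁₁ →
      IntegrableOn v₀₀ coordDisc → IntegrableOn v₁₀ coordDisc →
      IntegrableOn v₀₁ coordDisc → IntegrableOn v₁₁ coordDisc →
      ∀ z₀ : ℂ, ‖z₀‖ ≤ 1 → ‖u z₀‖ ≤ C * ((∫ z in coordDisc, ‖v₀₀ z‖) +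
        (∫ z in coordDisc, ‖v₁₀ z‖) + (∫ z in coordDisc, ‖v₀₁ z‖) +
        ∫ z in coordDisc, ‖v₁₁ z‖) := by
  let χ : ContDiffBump (0 : ℂ) := ⟨1, 3 / 2, by norm_num, by norm_num⟩
  have hχ : ContDiff ℝ ∞ χ := χ.contDiff
  have hχs : HasCompactSupport χ := χ.hasCompactSupport
  have hχt : tsupport χ ⊆ coordDisc := by
    rw [χ.tsupport_eq]
    exact Metric.closedBall_subset_ball (by norm_num [χ])
  -- the derivatives of `χ` that occur are again bounded, with support in the disc
  have hsub : ∀ {ψ : ℂ → ℝ} (c : ℂ), tsupport ψ ⊆ coordDisc →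
      tsupport (fun z ↦ fderiv ℝ ψ z c) ⊆ coordDisc :=
    fun c h ↦ (tsupport_fderiv_apply_subset ℝ c).trans h
  have hbd : ∀ {ψ : ℂ → ℝ}, ContDiff ℝ ∞ ψ → HasCompactSupport ψ → ∃ C, ∀ z, ‖ψ z‖ ≤ C :=
    fun h h' ↦ h'.exists_bound_of_continuous h.continuous
  let χx : ℂ → ℝ := fun z ↦ fderiv ℝ χ z 1
  let χy : ℂ → ℝ := fun z ↦ fderiv ℝ χ z Complex.I
  let χxy : ℂ → ℝ := fun z ↦ fderiv ℝ χx z Complex.I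
  have sx : ContDiff ℝ ∞ χx := hχ.fderiv_direction 1
  have sy : ContDiff ℝ ∞ χy := hχ.fderiv_direction Complex.I
  have sxy : ContDiff ℝ ∞ χxy := sx.fderiv_direction Complex.I
  have kx : HasCompactSupport χx := hχs.fderiv_apply ℝ 1
  have ky : HasCompactSupport χy := hχs.fderiv_apply ℝ Complex.I
  have kxy : HasCompactSupport χxy := kx.fderiv_apply ℝ Complex.I
  have tx : tsupport χx ⊆ coordDisc := hsub 1 hχt
  have ty : tsupport χy ⊆ coordDisc := hsub Complex.I hχt
  have txy : tsupport χxy ⊆ coordDisc := hsub Complex.I tx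
  obtain ⟨C₁, h₁⟩ := hbd hχ hχs
  obtain ⟨C₂, h₂⟩ := hbd sx kx
  obtain ⟨C₃, h₃⟩ := hbd sy ky
  obtain ⟨C₄, h₄⟩ := hbd sxy kxy
  let C := max (max C₁ C₂) (max C₃ C₄)
  have h₁ : ∀ z, ‖χ z‖ ≤ C := fun z ↦ (h₁ z).trans (by simp [C])
  have h₂ : ∀ z, ‖χx z‖ ≤ C := fun z ↦ (h₂ z).trans (by simp [C])
  have h₃ : ∀ z, ‖χy z‖ ≤ C := fun z ↦ (h₃ z).trans (by simp [C])
  have h₄ : ∀ z, ‖χxy z‖ ≤ C := fun z ↦ (h₄ z).trans (by simp [C])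
  refine ⟨C, (norm_nonneg _).trans (h₁ 0), ?_⟩
  intro u v₀₀ v₁₀ v₀₁ v₁₁ hu w₀₀ w₁₀ w₀₁ w₁₁ i₀₀ i₁₀ i₀₁ i₁₁ z₀ hz₀
  have hval : u z₀ = χ z₀ • u z₀ := by
    rw [χ.one_of_mem_closedBall (by simpa [χ] using hz₀), one_smul]
  rw [hval]
  refine norm_le_of_norm_integral_mollifier_le (w := fun z ↦ χ z • u z)
    (hχ.continuous.smul hu) z₀ fun h ρ hh hd hb ↦ ?_
  let H : ℂ → ℝ := fun z ↦ h (z - z₀).re * h (z - z₀).im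
  have sre : ContDiff ℝ ∞ fun z : ℂ ↦ h (z - z₀).re :=
    hh.comp (Complex.reCLM.contDiff.comp (contDiff_id.sub contDiff_const))
  have sim : ContDiff ℝ ∞ fun z : ℂ ↦ h (z - z₀).im :=
    hh.comp (Complex.imCLM.contDiff.comp (contDiff_id.sub contDiff_const))
  have sH : ContDiff ℝ ∞ H := sre.mul sim
  have dre : ∀ z c : ℂ, fderiv ℝ (fun z : ℂ ↦ h (z - z₀).re) z c = ρ (z - z₀).re * c.re := by
    intro z c
    have h1 : HasFDerivAt (fun z : ℂ ↦ (z - z₀).re) Complex.reCLM z :=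
      Complex.reCLM.hasFDerivAt.comp z ((hasFDerivAt_id z).sub_const z₀)
    have h2 := (hd (z - z₀).re).comp_hasFDerivAt z h1
    change fderiv ℝ (h ∘ fun z : ℂ ↦ (z - z₀).re) z c = _
    rw [h2.fderiv]
    simp
  have dim : ∀ {h ρ : ℝ → ℝ}, (∀ t, HasDerivAt h (ρ t) t) → ∀ z c : ℂ,
      fderiv ℝ (fun z : ℂ ↦ h (z - z₀).im) z c = ρ (z - z₀).im * c.im := by
    intro h ρ hd z c
    have h1 : HasFDerivAt (fun z : ℂ ↦ (z - z₀).im) Complex.imCLM z :=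
      Complex.imCLM.hasFDerivAt.comp z ((hasFDerivAt_id z).sub_const z₀)
    have h2 := (hd (z - z₀).im).comp_hasFDerivAt z h1
    change fderiv ℝ (h ∘ fun z : ℂ ↦ (z - z₀).im) z c = _
    rw [h2.fderiv]
    simp
  have dH : (fun z ↦ fderiv ℝ H z Complex.I) = fun z ↦ h (z - z₀).re * ρ (z - z₀).im := by
    funext z
    rw [fderiv_mul_direction sre sim, dre, dim hd]
    simp
  have ddH : ∀ z, fderiv ℝ (fun w ↦ fderiv ℝ H w Complex.I) z 1 =
      ρ (z - z₀).re * ρ (z - z₀).im := by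
    intro z
    have sρ : ContDiff ℝ ∞ ρ := by
      rw [← show deriv h = ρ from funext fun t ↦ (hd t).deriv]
      exact (contDiff_infty_iff_deriv.mp hh).2
    have sρim : ContDiff ℝ ∞ fun z : ℂ ↦ ρ (z - z₀).im :=
      sρ.comp (Complex.imCLM.contDiff.comp (contDiff_id.sub contDiff_const))
    rw [dH, fderiv_mul_direction sre sρim, dre,
      dim fun t ↦ (sρ.differentiable (by simp) t).hasDerivAt]
    simp
  have bH : ∀ z, ‖H z‖ ≤ 1 := by
    intro z
    rw [norm_mul]
    exact mul_le_one₀ (hb _) (norm_nonneg _) (hb _)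
  have test : ∀ {ψ : ℂ → ℝ}, ContDiff ℝ ∞ ψ → HasCompactSupport ψ → tsupport ψ ⊆ coordDisc →
      ContDiff ℝ ∞ (fun z ↦ ψ z * H z) ∧ HasCompactSupport (fun z ↦ ψ z * H z) ∧
      tsupport (fun z ↦ ψ z * H z) ⊆ coordDisc :=
    fun h h' h'' ↦ ⟨h.mul sH, h'.mul_right, (tsupport_mul_subset_left).trans h''⟩
  have int : ∀ {ψ : ℂ → ℝ}, ContDiff ℝ ∞ ψ → HasCompactSupport ψ →
      Integrable fun z ↦ ψ z • u z :=
    fun h h' ↦ (h.continuous.smul hu).integrable_of_hasCompactSupport h'.smul_right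
  obtain ⟨a₁, b₁, c₁⟩ := test hχ hχs hχt
  obtain ⟨a₂, b₂, c₂⟩ := test sx kx tx
  obtain ⟨a₃, b₃, c₃⟩ := test sy ky ty
  obtain ⟨a₄, b₄, c₄⟩ := test sxy kxy txy
  have e₁ := w₁₁.integral_eq _ a₁ b₁ c₁
  have e₂ := w₀₁.integral_eq _ a₂ b₂ c₂
  have e₃ := w₁₀.integral_eq _ a₃ b₃ c₃
  have e₄ := w₀₀.integral_eq _ a₄ b₄ c₄
  simp only [classicalPartial, Function.iterate_one, Function.iterate_zero, id] at e₁ e₂ e₃ e₄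
  norm_num at e₁ e₂ e₃ e₄
  have J₁ := int ((a₁.fderiv_direction Complex.I).fderiv_direction 1)
    ((b₁.fderiv_apply ℝ Complex.I).fderiv_apply ℝ 1)
  have J₂ := int (a₂.fderiv_direction Complex.I) (b₂.fderiv_apply ℝ Complex.I)
  have J₃ := int (a₃.fderiv_direction 1) (b₃.fderiv_apply ℝ 1)
  have J₄ := int a₄ b₄
  have key : ∫ z : ℂ, (ρ (z - z₀).re * ρ (z - z₀).im) • χ z • u z =
      (∫ z, (χ z * H z) • v₁₁ z) + (∫ z, (χy z * H z) • v₁₀ z) +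
        (∫ z, (χx z * H z) • v₀₁ z) + ∫ z, (χxy z * H z) • v₀₀ z := by
    -- integrate the Leibniz identity against `u` and move the derivatives to `u`
    have hpt : ∀ z : ℂ, (ρ (z - z₀).re * ρ (z - z₀).im) • χ z • u z =
        fderiv ℝ (fun w ↦ fderiv ℝ (fun w ↦ χ w * H w) w Complex.I) z 1 • u z
        - fderiv ℝ (fun w ↦ χy w * H w) z 1 • u z
        - fderiv ℝ (fun w ↦ χx w * H w) z Complex.I • u z + (χxy z * H z) • u z := by
      intro z
      rw [smul_smul, mul_comm, ← ddH, mul_fderiv_fderiv_eq hχ sH, add_smul, sub_smul, sub_smul]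
    simp_rw [hpt]
    have J₁₃ := J₁.sub J₃
    have J₁₃₂ := J₁₃.sub J₂
    simp only [Pi.sub_def] at J₁₃ J₁₃₂
    rw [integral_add J₁₃₂ J₄, integral_sub J₁₃ J₂, integral_sub J₁ J₃,
      e₁, e₂, e₃, e₄]
    abel
  rw [key]
  have n₁ := norm_integral_mul_smul_le h₁ hχt bH i₁₁
  have n₂ := norm_integral_mul_smul_le h₂ tx bH i₀₁
  have n₃ := norm_integral_mul_smul_le h₃ ty bH i₁₀
  have n₄ := norm_integral_mul_smul_le h₄ txy bH i₀₀
  refine (norm_add_le_of_le (norm_add_le_of_le (norm_add_le_of_le n₁ n₃) n₂) n₄).trans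
    (le_of_eq ?_)
  ring

end SupBound

/-! ### The Sobolev distance controls the uniform distance -/

/-- On a finite measure space, the `L¹` distance is bounded by a multiple of the `Lᵖ` distance. -/
theorem exists_forall_integral_norm_sub_le_dist_toLp {X V : Type*} [MeasurableSpace X]
    [NormedAddCommGroup V] (μ : Measure X) [IsFiniteMeasure μ] (p : ℝ≥0∞) [Fact (1 ≤ p)] :
    ∃ C : ℝ, 0 ≤ C ∧ ∀ (v w : X → V) (hv : MemLp v p μ) (hw : MemLp w p μ),
      ∫ z, ‖v z - w z‖ ∂μ ≤ C * dist (hv.toLp v) (hw.toLp w) := by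
  have hp : 1 ≤ p := Fact.out
  let c : ℝ≥0∞ := μ univ ^ (1 / (1 : ℝ≥0∞).toReal - 1 / p.toReal)
  have hexp : 0 ≤ 1 / (1 : ℝ≥0∞).toReal - 1 / p.toReal := by
    rcases eq_or_ne p ⊤ with rfl | hpt
    · simp
    · have h1 : 1 ≤ p.toReal := by
        simpa using ENNReal.toReal_mono hpt hp
      simpa using inv_le_one_of_one_le₀ h1
  have hc : c ≠ ⊤ := ENNReal.rpow_ne_top_of_nonneg hexp (measure_ne_top μ univ)
  refine ⟨c.toReal, ENNReal.toReal_nonneg, fun v w hv hw ↦ ?_⟩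
  have hvw : MemLp (v - w) p μ := hv.sub hw
  rw [dist_eq_norm, ← MemLp.toLp_sub hv hw, Lp.norm_toLp, ← ENNReal.toReal_mul, mul_comm]
  have h1 : ∫ z, ‖v z - w z‖ ∂μ = (eLpNorm (v - w) 1 μ).toReal := by
    rw [eLpNorm_one_eq_lintegral_enorm]
    exact integral_norm_eq_lintegral_enorm hvw.1
  rw [h1]
  exact ENNReal.toReal_mono (ENNReal.mul_ne_top hvw.2.ne hc)
    (eLpNorm_le_eLpNorm_mul_rpow_measure_univ hp hvw.1)

instance instIsFiniteMeasureCoordDisc :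
    IsFiniteMeasure ((volume : Measure ℂ).restrict coordDisc) :=
  ⟨by rw [Measure.restrict_apply_univ]; exact measure_ball_lt_top⟩

namespace SobolevMap

variable {k : ℕ} {p : ℝ≥0∞} {M : Type*} [TopologicalSpace M] {m : ℕ}
  {e : M → EuclideanSpace ℝ (Fin m)}

theorem exists_forall_dist_le [Fact (1 ≤ p)] (he : Continuous e) (hk : 2 ≤ k) :
    ∃ C : ℝ, 0 ≤ C ∧ ∀ (f h : SobolevMap k p e) (x : OnePoint ℂ),
      dist (e (f x)) (e (h x)) ≤ C * dist f h := by
  have hp : 1 ≤ p := Fact.out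
  obtain ⟨C, hC0, hC⟩ :=
    exists_forall_norm_le_integral_weakPartial (V := EuclideanSpace ℝ (Fin m))
  obtain ⟨D, hD0, hD⟩ := exists_forall_integral_norm_sub_le_dist_toLp
    (V := EuclideanSpace ℝ (Fin m)) ((volume : Measure ℂ).restrict coordDisc) p
  refine ⟨C * (4 * D), by positivity, fun f h x ↦ ?_⟩
  obtain ⟨i, z, hz, rfl⟩ := exists_sphereParam_eq x
  have hcont : ∀ f : SobolevMap k p e, Continuous fun z ↦ e (f (sphereParam i z)) :=
    fun f ↦ he.comp (f.toContinuousMap.continuous.comp (continuous_sphereParam i))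
  have hpart : ∀ a b : ℕ, a + b ≤ 2 → ∃ v : ℂ → EuclideanSpace ℝ (Fin m),
      HasWeakPartial coordDisc a b
        (fun z ↦ e (f (sphereParam i z)) - e (h (sphereParam i z))) v ∧
      IntegrableOn v coordDisc ∧ ∫ z in coordDisc, ‖v z‖ ≤ D * dist f h := by
    intro a b hab
    let α : MultiIndex k := ⟨(⟨a, by omega⟩, ⟨b, by omega⟩), show a + b ≤ k by omega⟩
    have hf := (f.exists_weakPartial i α).choose_spec
    have hh := (h.exists_weakPartial i α).choose_spec
    have hfi := hf.1.integrable hp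
    have hhi := hh.1.integrable hp
    refine ⟨_, hf.2.sub hh.2 (hcont f) (hcont h) hfi hhi, hfi.sub hhi, ?_⟩
    refine (hD _ _ hf.1 hh.1).trans (mul_le_mul_of_nonneg_left ?_ hD0)
    exact (dist_le_pi_dist (f.jet i) (h.jet i) α).trans (dist_le_pi_dist f.jet h.jet i)
  obtain ⟨v₀₀, w₀₀, i₀₀, n₀₀⟩ := hpart 0 0 (by norm_num)
  obtain ⟨v₁₀, w₁₀, i₁₀, n₁₀⟩ := hpart 1 0 (by norm_num)
  obtain ⟨v₀₁, w₀₁, i₀₁, n₀₁⟩ := hpart 0 1 (by norm_num)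
  obtain ⟨v₁₁, w₁₁, i₁₁, n₁₁⟩ := hpart 1 1 (by norm_num)
  rw [dist_eq_norm]
  refine (hC _ v₀₀ v₁₀ v₀₁ v₁₁ ((hcont f).sub (hcont h)) w₀₀ w₁₀ w₀₁ w₁₁ i₀₀ i₁₀ i₀₁ i₁₁
    z hz).trans ?_
  rw [mul_assoc]
  refine mul_le_mul_of_nonneg_left ?_ hC0
  linarith

/-- Properness with respect to the uniform distance, transferred to the Sobolev distance. -/
theorem exists_radius_compact [Fact (1 ≤ p)] (he : IsEmbedding e) (hk : 2 ≤ k)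
    {G : Subgroup PSL(2, ℂ)} (hG : IsClosed (G : Set PSL(2, ℂ)))
    (f₁ f₂ : NonconstantSobolevMap k p e) :
    ∃ r > 0, ∃ K : Set G, IsCompact K ∧ ∀ h ∈ Metric.ball f₁ r, ∀ g : G, g ∉ K →
      ¬ ∃ h' ∈ Metric.ball f₂ r, ∀ x : OnePoint ℂ, h'.1 x = h.1 ((g : PSL(2, ℂ)) • x) := by
  obtain ⟨C, hC0, hC⟩ := exists_forall_dist_le (k := k) (p := p) he.continuous hk
  obtain ⟨x, y, hxy⟩ := f₂.2
  obtain ⟨δ, hδ, R, hR⟩ := exists_forall_notMem_boundedPSL_lt_dist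
    (F₁ := fun x ↦ e (f₁.1 x)) (F₂ := fun x ↦ e (f₂.1 x))
    (he.continuous.comp f₁.1.toContinuousMap.continuous)
    (he.continuous.comp f₂.1.toContinuousMap.continuous) ⟨x, y, he.injective.ne hxy⟩
  refine ⟨δ / (2 * (C + 1)), by positivity, Subtype.val ⁻¹' boundedPSL R,
    hG.isClosedEmbedding_subtypeVal.isCompact_preimage (isCompact_boundedPSL R), ?_⟩
  rintro h hh g hg ⟨h', hh', heq⟩
  obtain ⟨x, hx⟩ := hR g hg
  have h1 := hC f₂.1 h'.1 x
  have h2 := hC h.1 f₁.1 ((g : PSL(2, ℂ)) • x)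
  have d1 : dist f₂.1 h'.1 < δ / (2 * (C + 1)) := by
    rw [dist_comm]
    exact hh'
  have d2 : dist h.1 f₁.1 < δ / (2 * (C + 1)) := hh
  rw [lt_div_iff₀ (by positivity)] at d1 d2
  rw [heq x] at h1
  have htri := dist_triangle (e (f₂.1 x)) (e (h.1 ((g : PSL(2, ℂ)) • x)))
    (e (f₁.1 ((g : PSL(2, ℂ)) • x)))
  have n1 : 0 ≤ dist f₂.1 h'.1 := dist_nonneg
  have n2 : 0 ≤ dist h.1 f₁.1 := dist_nonneg
  linarith

end SobolevMap

/-! ### Properness of the action -/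

theorem two_le_of_one_add_two_div_lt {k : ℕ} {p : ℝ≥0∞} (hkp : 1 + 2 / p < (k : ℝ≥0∞)) :
    2 ≤ k := by
  have h : (1 : ℝ≥0∞) < k := lt_of_le_of_lt le_self_add hkp
  exact_mod_cast h

theorem theorem1p1
    -- the target: a compact smooth manifold, smoothly embedded in a Euclidean space
    {d : ℕ} {M : Type*} [TopologicalSpace M] [T2Space M] [CompactSpace M]
    [ChartedSpace (EuclideanSpace ℝ (Fin d)) M] [IsManifold (𝓡 d) ∞ M]
    {m : ℕ} (e : M → EuclideanSpace ℝ (Fin m))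
    (he_smooth : ContMDiff (𝓡 d) (𝓡 m) ∞ e) (he_emb : IsEmbedding e)
    (he_imm : ∀ x : M, Function.Injective (mfderiv (𝓡 d) (𝓡 m) e x))
    -- the exponents
    (k : ℕ) (p : ℝ≥0∞) [Fact (1 ≤ p)] (hkp : 1 + 2 / p < (k : ℝ≥0∞))
    -- the reparametrization group
    (G : Subgroup PSL(2, ℂ)) (hG : IsReparametrizationGroup G)
    (f₁ f₂ : NonconstantSobolevMap k p e) :
    ∃ U₁ ∈ 𝓝 f₁, ∃ U₂ ∈ 𝓝 f₂, ∃ K₁ K₂ : Set G, IsCompact K₁ ∧ IsCompact K₂ ∧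
      (∀ h ∈ U₁, ∀ g : G, g ∉ K₁ →
        ¬ ∃ h' ∈ U₂, ∀ x : OnePoint ℂ, h'.1 x = h.1 ((g : PSL(2, ℂ)) • x)) ∧
      (∀ h ∈ U₂, ∀ g : G, g ∉ K₂ →
        ¬ ∃ h' ∈ U₁, ∀ x : OnePoint ℂ, h'.1 x = h.1 ((g : PSL(2, ℂ)) • x)) := by
  have hk := two_le_of_one_add_two_div_lt hkp
  obtain ⟨r, hr, K₁, hK₁, H₁⟩ :=
    SobolevMap.exists_radius_compact he_emb hk hG.isClosed f₁ f₂
  obtain ⟨s, hs, K₂, hK₂, H₂⟩ :=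
    SobolevMap.exists_radius_compact he_emb hk hG.isClosed f₂ f₁
  have hmin : 0 < min r s := lt_min hr hs
  refine ⟨Metric.ball f₁ (min r s), Metric.ball_mem_nhds f₁ hmin,
    Metric.ball f₂ (min r s), Metric.ball_mem_nhds f₂ hmin, K₁, K₂, hK₁, hK₂, ?_, ?_⟩
  · rintro h hh g hg ⟨h', hh', heq⟩
    exact H₁ h (Metric.ball_subset_ball (min_le_left r s) hh) g hg
      ⟨h', Metric.ball_subset_ball (min_le_left r s) hh', heq⟩
  · rintro h hh g hg ⟨h', hh', heq⟩
    exact H₂ h (Metric.ball_subset_ball (min_le_right r s) hh) g hg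
      ⟨h', Metric.ball_subset_ball (min_le_right r s) hh', heq⟩
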